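/- **Lemma 4.2.** Let $n\ge 1$, let $z_1,\dots,z_n$ be the coordinates of $Z=\mathbb C^n$, and let $h=\sum_{i=1}^n z_i^2$. Let $\Omega^p$ be the space of algebraic differential $p$-forms on $Z$ (differential forms with coefficients in $\mathbb C[z_1,\dots,z_n]$), with $\Omega^{-1}=0$, and let $\Omega^p_j$ ($j\in\mathbb Z$) be its part of degree $j$ for the grading given by $\deg z_i=\deg dz_i=1$; that is, $\Omega^p_j$ consists of the $p$-forms whose coefficients are homogeneous polynomials of degree $j-p$, and is zero if $j<p$. For $q\in\mathbb Z$ define $D'_q:\Omega^p\to\Omega^{p+1}$ by $$D'_q\eta = h\,d\eta - q\,dh\wedge\eta ,$$ which maps $\Omega^p_j$ into $\Omega^{p+1}_{j+2}$. Let $j,q\in\mathbb Z$ with $j\ne 2q$ and $2q\ne 0$. Then: (i) if $j+2>n$, then $D'_q:\Omega^{n-1}_j\to\Omega^n_{j+2}$ is surjective; (ii) if $q\ne 1$, then $$\operatorname{Im}\bigl(D'_{q-1}:\Omega^{n-2}_{j-2}\to\Omega^{n-1}_{j}\bigr)=\operatorname{Ker}\bigl(D'_q:\Omega^{n-1}_j\to\Omega^n_{j+2}\bigr).$$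 -/

import Mathlib

noncomputable section

/-- Algebraic differential `p`-forms on `Z = ℂⁿ`, i.e. elements of `ℂ[z₁,…,zₙ] ⊗ ⋀ᵖ(ℂⁿ)*`:
alternating `p`-linear maps which take `p` constant vector fields to a polynomial. -/
abbrev PolyForm (n p : ℕ) : Type :=
  (Fin n → ℂ) [⋀^Fin p]→ₗ[ℂ] MvPolynomial (Fin n) ℂ

namespace PolyForm

variable {n p : ℕ}

/-- The derivative `∂_v = ∑ᵢ vᵢ ∂/∂zᵢ` of polynomials along a constant vector field `v`,
depending linearly on `v`. -/
def dirDeriv (n : ℕ) :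
    (Fin n → ℂ) →ₗ[ℂ] (MvPolynomial (Fin n) ℂ →ₗ[ℂ] MvPolynomial (Fin n) ℂ) where
  toFun v := ∑ i, v i • (MvPolynomial.pderiv i).toLinearMap
  map_add' v w := by simp [add_smul, Finset.sum_add_distrib]
  map_smul' c v := by simp [mul_smul, Finset.smul_sum]

/-- The differential `df` of a polynomial `f`, as the linear map `v ↦ ∂_v f`. -/
def differential (f : MvPolynomial (Fin n) ℂ) :
    (Fin n → ℂ) →ₗ[ℂ] MvPolynomial (Fin n) ℂ :=
  (dirDeriv n).flip f

/-- Exterior multiplication `ω ↦ α ∧ ω` by a 1-form `α`: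
`(α ∧ ω)(v₀,…,v_p) = ∑ᵢ (-1)ⁱ α(vᵢ) ω(v₀,…,v̂ᵢ,…,v_p)`. -/
def wedgeLeft (α : (Fin n → ℂ) →ₗ[ℂ] MvPolynomial (Fin n) ℂ) :
    PolyForm n p →ₗ[ℂ] PolyForm n (p + 1) where
  toFun ω := AlternatingMap.alternatizeUncurryFin
    { toFun := fun v => α v • ω
      map_add' := fun v w => by simp [add_smul]
      map_smul' := fun c v => by ext1 u; simp }
  map_add' ω η := by
    ext v; simp [AlternatingMap.alternatizeUncurryFin_apply, Finset.sum_add_distrib]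
  map_smul' c ω := by
    ext1 v; simp [AlternatingMap.alternatizeUncurryFin_apply, Finset.smul_sum]

/-- The exterior derivative:
`(dω)(v₀,…,v_p) = ∑ᵢ (-1)ⁱ ∂_{vᵢ} (ω(v₀,…,v̂ᵢ,…,v_p))` for constant vector fields `vᵢ`. -/
def extD : PolyForm n p →ₗ[ℂ] PolyForm n (p + 1) where
  toFun ω := AlternatingMap.alternatizeUncurryFin
    { toFun := fun v => (dirDeriv n v).compAlternatingMap ω
      map_add' := fun v w => by ext1; simp
      map_smul' := fun c v => by ext1; simp }
  map_add' ω η := by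
    ext1 v; simp [AlternatingMap.alternatizeUncurryFin_apply, Finset.sum_add_distrib]
  map_smul' c ω := by
    ext1 v; simp [AlternatingMap.alternatizeUncurryFin_apply, Finset.smul_sum]

/-- The quadratic form `h = ∑ᵢ zᵢ²`. -/
def quad (n : ℕ) : MvPolynomial (Fin n) ℂ := ∑ i, MvPolynomial.X i ^ 2

/-- The operator `D'_q η = h dη - q dh ∧ η`. -/
def twistedD (q : ℤ) : PolyForm n p →ₗ[ℂ] PolyForm n (p + 1) where
  toFun η := quad n • extD η - q • wedgeLeft (differential (quad n)) η
  map_add' η ξ := by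
    simp only [map_add, smul_add]; abel
  map_smul' c η := by
    simp only [map_smul, RingHom.id_apply, smul_sub, smul_comm c]

/-- The degree `j` part `Ω^p_j` for the grading `deg zᵢ = deg dzᵢ = 1`: the coefficients of a
`p`-form of degree `j` are homogeneous polynomials of degree `j - p` (so they vanish if `j < p`). -/
def degPart (n p : ℕ) (j : ℤ) : Submodule ℂ (PolyForm n p) where
  carrier := {ω | ∀ v, ω v ∈ MvPolynomial.weightedHomogeneousSubmodule ℂ
    (fun _ : Fin n => (1 : ℤ)) (j - p)}
  add_mem' ha hb v := Submodule.add_mem _ (ha v) (hb v)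
  zero_mem' _ := Submodule.zero_mem _
  smul_mem' c _ ha v := Submodule.smul_mem _ c (ha v)

/-- The image of `D'_q : Ω^{p-1}_j → Ω^p`, where `Ω^{-1} = 0`. -/
def imageTwistedD (n : ℕ) (q j : ℤ) : (p : ℕ) → Submodule ℂ (PolyForm n p)
  | 0 => ⊥
  | p + 1 => (degPart n p j).map (twistedD q)

end PolyForm

end

/-!
Contracting the volume form identifies forms of degree `n - 1` with polynomial vector fields `ξ`
(`eq_vecForm`), and bivector fields `B` give forms of degree `n - 2`. In these terms
(`twistedD_vecForm`, `twistedD_bivecForm`)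

* `D'_q ξ = h div ξ - 2q z · ξ`, a multiple of the volume form;
* `D'_{q-1} B = h div B - 2(q - 1) z · B`, with `(div B)_b = ∑ₐ ∂ₐ B_{ab}` and
  `(z · B)_b = ∑ₐ zₐ B_{ab}`.

Let `E = ∑ₐ zₐ ∂ₐ` be the Euler field. If `g E` corresponds to a form of degree `j`, then
`D'_q (g E) = (j - 2q) h g`, so multiples of `h` are attained as `j ≠ 2q`. Euler's identity writes
any `f` of positive degree as `-2q z · ζ`, which gives surjectivity (`exists_vector_field`).

For exactness, `D'_q ∘ D'_{q-1} = 0` is a formal computation (`twistedD_twistedD_sub_one`).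
Conversely, if `D'_q ξ = 0`, then `z · ξ = h g` with `g = div ξ / (2q)`, hence `z · (ξ - g E) = 0`,
and exactness of the Koszul complex (`exists_sum_X_mul_sub_eq`) gives
`ξ - g E = -2(q - 1) z · B`. With `w = div B`, which is divergence free, it follows that
`ξ - D'_{q-1} B = g E - h w`; taking divergences shows `(j - 2q) g = -2(q - 1) z · w`, and then
`g E - h w = D'_{q-1} (E ∧ u)` with `u = -w / (j - 2q)` (`exists_bivector_field`).
-/

namespace PolyForm

open MvPolynomial

/-! ### Calculus of the operators `d`, `α ∧ ·` and `D'_q` -/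

theorem dirDeriv_apply {n : ℕ} (v : Fin n → ℂ) (f : MvPolynomial (Fin n) ℂ) :
    dirDeriv n v f = ∑ i, v i • pderiv i f := by
  simp [dirDeriv, LinearMap.sum_apply]

theorem differential_apply {n : ℕ} (f : MvPolynomial (Fin n) ℂ) (v : Fin n → ℂ) :
    differential f v = ∑ i, v i • pderiv i f :=
  dirDeriv_apply v f

theorem differential_single {n : ℕ} (f : MvPolynomial (Fin n) ℂ) (i : Fin n) :
    differential f (Pi.single i 1) = pderiv i f := by
  simp [differential_apply, Pi.single_apply]

theorem dirDeriv_mul {n : ℕ} (v : Fin n → ℂ) (f g : MvPolynomial (Fin n) ℂ) :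
    dirDeriv n v (f * g) = dirDeriv n v f * g + f * dirDeriv n v g := by
  simp only [dirDeriv_apply, pderiv_mul, smul_add, Finset.sum_add_distrib, Finset.sum_mul,
    Finset.mul_sum, smul_mul_assoc, mul_smul_comm]

theorem pderiv_comm {n : ℕ} (i j : Fin n) (f : MvPolynomial (Fin n) ℂ) :
    pderiv i (pderiv j f) = pderiv j (pderiv i f) := by
  have h : ⁅(pderiv i : Derivation ℂ (MvPolynomial (Fin n) ℂ) (MvPolynomial (Fin n) ℂ)),
      (pderiv j : Derivation ℂ (MvPolynomial (Fin n) ℂ) (MvPolynomial (Fin n) ℂ))⁆ = 0 := by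
    refine MvPolynomial.derivation_ext fun k => ?_
    rw [Derivation.commutator_apply, pderiv_X, pderiv_X]
    simp only [Pi.single_apply]
    split_ifs <;> simp
  have := congr($h f)
  rwa [Derivation.commutator_apply, Derivation.zero_apply, sub_eq_zero] at this

theorem dirDeriv_comm {n : ℕ} (v w : Fin n → ℂ) (f : MvPolynomial (Fin n) ℂ) :
    dirDeriv n v (dirDeriv n w f) = dirDeriv n w (dirDeriv n v f) := by
  simp only [dirDeriv_apply, map_sum, map_smul, Finset.smul_sum]
  rw [Finset.sum_comm]
  refine Finset.sum_congr rfl fun i _ => Finset.sum_congr rfl fun j _ => ?_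
  rw [smul_comm, pderiv_comm]

theorem wedgeLeft_apply {n p : ℕ} (α : (Fin n → ℂ) →ₗ[ℂ] MvPolynomial (Fin n) ℂ)
    (ω : PolyForm n p) (v : Fin (p + 1) → Fin n → ℂ) :
    wedgeLeft α ω v = ∑ i : Fin (p + 1), (-1) ^ (i : ℕ) * (α (v i) * ω (i.removeNth v)) := by
  simp [wedgeLeft, AlternatingMap.alternatizeUncurryFin_apply]

theorem extD_apply {n p : ℕ} (ω : PolyForm n p) (v : Fin (p + 1) → Fin n → ℂ) :
    extD ω v = ∑ i : Fin (p + 1), (-1) ^ (i : ℕ) * dirDeriv n (v i) (ω (i.removeNth v)) := by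
  simp [extD, AlternatingMap.alternatizeUncurryFin_apply]

theorem wedgeLeft_smul {n p : ℕ} (α : (Fin n → ℂ) →ₗ[ℂ] MvPolynomial (Fin n) ℂ)
    (f : MvPolynomial (Fin n) ℂ) (ω : PolyForm n p) :
    wedgeLeft α (f • ω) = f • wedgeLeft α ω := by
  ext1 v
  simp only [wedgeLeft_apply, AlternatingMap.smul_apply, Finset.mul_sum, smul_eq_mul]
  refine Finset.sum_congr rfl fun i _ => ?_
  ring

theorem extD_smul {n p : ℕ} (f : MvPolynomial (Fin n) ℂ) (ω : PolyForm n p) :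
    extD (f • ω) = wedgeLeft (differential f) ω + f • extD ω := by
  ext1 v
  simp only [extD_apply, wedgeLeft_apply, AlternatingMap.smul_apply, AlternatingMap.add_apply,
    Finset.mul_sum, smul_eq_mul, ← Finset.sum_add_distrib, dirDeriv_mul]
  refine Finset.sum_congr rfl fun i _ => ?_
  rw [show differential f (v i) = dirDeriv n (v i) f from rfl]
  ring

theorem wedgeLeft_wedgeLeft {n p : ℕ} (α : (Fin n → ℂ) →ₗ[ℂ] MvPolynomial (Fin n) ℂ)
    (ω : PolyForm n p) : wedgeLeft α (wedgeLeft α ω) = 0 := by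
  let B : (Fin n → ℂ) →ₗ[ℂ] (Fin n → ℂ) →ₗ[ℂ] PolyForm n p :=
    LinearMap.mk₂ ℂ (fun v w => α v • α w • ω) (fun v w u => by simp [add_smul])
      (fun c v η => by ext1; simp) (fun v η ξ => by simp [add_smul])
      (fun c v η => by ext1; simp)
  have := AlternatingMap.alternatizeUncurryFin_alternatizeUncurryFinLM_comp_of_symmetric (f := B)
    (fun v w => smul_comm _ _ _)
  rw [← this]
  ext1 v
  simp [wedgeLeft_apply, AlternatingMap.alternatizeUncurryFin_apply, B, Finset.mul_sum,
    mul_left_comm]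

theorem extD_extD {n p : ℕ} (ω : PolyForm n p) : extD (extD ω) = 0 := by
  let B : (Fin n → ℂ) →ₗ[ℂ] (Fin n → ℂ) →ₗ[ℂ] PolyForm n p :=
    LinearMap.mk₂ ℂ (fun v w => (dirDeriv n v ∘ₗ dirDeriv n w).compAlternatingMap ω)
      (fun v w u => by ext1; simp) (fun c v η => by ext1; simp) (fun v η ξ => by ext1; simp)
      (fun c v η => by ext1; simp)
  have := AlternatingMap.alternatizeUncurryFin_alternatizeUncurryFinLM_comp_of_symmetric (f := B)
    (fun v w => by ext1; simp [B, dirDeriv_comm v w])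
  rw [← this]
  ext1 v
  have hc : ∀ (k : ℕ) (x : Fin n → ℂ) (f : MvPolynomial (Fin n) ℂ),
      dirDeriv n x ((-1) ^ k * f) = (-1) ^ k * dirDeriv n x f := fun k x f => by
    rcases neg_one_pow_eq_or (MvPolynomial (Fin n) ℂ) k with h | h <;> simp [h]
  simp [extD_apply, AlternatingMap.alternatizeUncurryFin_apply, B, hc]

theorem extD_wedgeLeft_differential {n p : ℕ} (f : MvPolynomial (Fin n) ℂ) (ω : PolyForm n p) :
    extD (wedgeLeft (differential f) ω) = -wedgeLeft (differential f) (extD ω) := by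
  have h := extD_extD (f • ω)
  rw [extD_smul, map_add, extD_smul, extD_extD, smul_zero, add_zero] at h
  exact eq_neg_of_add_eq_zero_left h

theorem twistedD_apply {n p : ℕ} (q : ℤ) (ω : PolyForm n p) :
    twistedD q ω = quad n • extD ω - q • wedgeLeft (differential (quad n)) ω :=
  rfl

/-- `D'_q ∘ D'_{q-1} = 0`: the terms `h dh ∧ dω` occur with total coefficient
`1 + (q - 1) - q = 0`. -/
theorem twistedD_twistedD_sub_one {n p : ℕ} (q : ℤ) (ω : PolyForm n p) :
    twistedD q (twistedD (q - 1) ω) = 0 := by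
  simp only [twistedD_apply, map_sub, map_zsmul, extD_smul, wedgeLeft_smul, extD_extD,
    extD_wedgeLeft_differential, wedgeLeft_wedgeLeft]
  module

/-- Contraction by a constant vector field (that is, `AlternatingMap.curryLeft`) is an
antiderivation with respect to exterior multiplication by a 1-form. -/
theorem wedgeLeft_curryLeft {n p : ℕ} (α : (Fin n → ℂ) →ₗ[ℂ] MvPolynomial (Fin n) ℂ)
    (ω : PolyForm n (p + 1)) (x : Fin n → ℂ) :
    wedgeLeft α (ω.curryLeft x) = α x • ω - (wedgeLeft α ω).curryLeft x := by
  ext1 v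
  simp only [AlternatingMap.sub_apply, AlternatingMap.smul_apply,
    AlternatingMap.curryLeft_apply_apply, wedgeLeft_apply]
  rw [Fin.sum_univ_succ (n := p + 1)]
  have hr : ∀ i : Fin (p + 1), i.succ.removeNth (Matrix.vecCons x v) =
      Matrix.vecCons x (i.removeNth v) := fun i => by
    ext1 k
    refine Fin.cases ?_ (fun k => ?_) k <;> simp [Fin.removeNth]
  have h0 : (0 : Fin (p + 2)).removeNth (Matrix.vecCons x v) = v := by
    ext1 k; simp [Fin.removeNth]
  simp [hr, h0, pow_succ]

/-! ### Vector fields and bivector fields as forms -/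

/-- The volume form `dz₁ ∧ ⋯ ∧ dz_n`, i.e. the determinant with values in constant polynomials. -/
noncomputable def vol (n : ℕ) : PolyForm n n :=
  (Algebra.linearMap ℂ (MvPolynomial (Fin n) ℂ)).compAlternatingMap (Pi.basisFun ℂ (Fin n)).det

theorem vol_single (n : ℕ) : vol n (fun i => Pi.single i 1) = 1 := by
  have := (Pi.basisFun ℂ (Fin n)).det_self
  have h2 : (fun i => Pi.single i 1) = ⇑(Pi.basisFun ℂ (Fin n)) := by ext1 i; simp
  rw [vol, LinearMap.compAlternatingMap_apply, h2, this]
  exact map_one (C : ℂ →+* MvPolynomial (Fin n) ℂ)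

theorem eq_zero_of_lt {n p : ℕ} (hp : n < p) (ω : PolyForm n p) : ω = 0 := by
  refine Module.Basis.ext_alternating (Pi.basisFun ℂ (Fin n)) fun v hv => ?_
  have := Fintype.card_le_of_injective v hv
  simp at this
  omega

theorem eq_smul_vol {n : ℕ} (ω : PolyForm n n) :
    ω = ω (fun i => Pi.single i 1) • vol n := by
  refine Module.Basis.ext_alternating (Pi.basisFun ℂ (Fin n)) fun v hv => ?_
  let σ : Equiv.Perm (Fin n) := Equiv.ofBijective v (Finite.injective_iff_bijective.1 hv)
  have h2 : (fun i => Pi.basisFun ℂ (Fin n) (v i)) = (fun i => Pi.single i 1) ∘ σ := by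
    ext1 i; simp [σ]
  rw [h2, AlternatingMap.smul_apply, AlternatingMap.map_perm, AlternatingMap.map_perm, vol_single]
  simp

theorem extD_eq_zero_of_const {n p : ℕ} (ω : PolyForm n p) (h : ∀ v, ∃ c, ω v = C c) :
    extD ω = 0 := by
  ext1 v
  rw [extD_apply]
  refine Finset.sum_eq_zero fun i _ => ?_
  obtain ⟨c, hc⟩ := h (i.removeNth v)
  simp [hc, dirDeriv_apply]

theorem exists_vol_apply_eq_C {n : ℕ} (v : Fin n → Fin n → ℂ) : ∃ c, vol n v = C c := ⟨_, rfl⟩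

/-- The `p`-form `ι_ξ vol` obtained by contracting the volume form of `ℂ^{p+1}` with the
polynomial vector field `ξ = ∑ₐ ξₐ ∂ₐ`. -/
noncomputable def vecForm {p : ℕ} (ξ : Fin (p + 1) → MvPolynomial (Fin (p + 1)) ℂ) :
    PolyForm (p + 1) p :=
  ∑ a, ξ a • (vol (p + 1)).curryLeft (Pi.single a 1)

/-- The `p`-form `∑ A_{ab} ι_a ι_b vol` on `ℂ^{p+2}`, where `ι_a` is the contraction with `∂ₐ`.
The array `A` need not be antisymmetric; the form depends only on the bivector field
`A_{ab} - A_{ba}`. -/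
noncomputable def bivecForm {p : ℕ}
    (A : Fin (p + 2) → Fin (p + 2) → MvPolynomial (Fin (p + 2)) ℂ) : PolyForm (p + 2) p :=
  ∑ a, ∑ b, A a b • ((vol (p + 2)).curryLeft (Pi.single b 1)).curryLeft (Pi.single a 1)

theorem wedgeLeft_curryLeft_vol {p : ℕ}
    (α : (Fin (p + 1) → ℂ) →ₗ[ℂ] MvPolynomial (Fin (p + 1)) ℂ) (x : Fin (p + 1) → ℂ) :
    wedgeLeft α ((vol (p + 1)).curryLeft x) = α x • vol (p + 1) := by
  rw [wedgeLeft_curryLeft, eq_zero_of_lt (Nat.lt_succ_self _) (wedgeLeft α _)]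
  simp

theorem wedgeLeft_vecForm {p : ℕ}
    (α : (Fin (p + 1) → ℂ) →ₗ[ℂ] MvPolynomial (Fin (p + 1)) ℂ)
    (ξ : Fin (p + 1) → MvPolynomial (Fin (p + 1)) ℂ) :
    wedgeLeft α (vecForm ξ) = (∑ a, α (Pi.single a 1) * ξ a) • vol (p + 1) := by
  simp only [vecForm, map_sum, wedgeLeft_smul, wedgeLeft_curryLeft_vol, Finset.sum_smul, mul_smul]
  exact Finset.sum_congr rfl fun a _ => smul_comm _ _ _

theorem extD_vecForm {p : ℕ} (ξ : Fin (p + 1) → MvPolynomial (Fin (p + 1)) ℂ) :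
    extD (vecForm ξ) = (∑ a, pderiv a (ξ a)) • vol (p + 1) := by
  simp only [vecForm, map_sum, extD_smul, wedgeLeft_curryLeft_vol, Finset.sum_smul,
    differential_single]
  refine Finset.sum_congr rfl fun a _ => ?_
  have h : extD ((vol (p + 1)).curryLeft (Pi.single a 1)) = 0 :=
    extD_eq_zero_of_const _ fun v => exists_vol_apply_eq_C _
  rw [h, smul_zero, add_zero]

theorem wedgeLeft_curryLeft_curryLeft_vol {p : ℕ}
    (α : (Fin (p + 2) → ℂ) →ₗ[ℂ] MvPolynomial (Fin (p + 2)) ℂ) (x y : Fin (p + 2) → ℂ) :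
    wedgeLeft α (((vol (p + 2)).curryLeft y).curryLeft x) =
      α x • (vol (p + 2)).curryLeft y - α y • (vol (p + 2)).curryLeft x := by
  rw [wedgeLeft_curryLeft, wedgeLeft_curryLeft_vol]
  rfl

theorem sum_sum_smul_sub {R M ι : Type*} [Ring R] [AddCommGroup M] [Module R M] [Fintype ι]
    (B B' : ι → ι → R) (e : ι → M) :
    ∑ a, ∑ b, (B a b • e b - B' a b • e a) = ∑ b, (∑ a, (B a b - B' b a)) • e b := by
  simp only [Finset.sum_sub_distrib, sub_smul, Finset.sum_smul]
  congr 1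
  exact Finset.sum_comm

theorem sum_smul_sub_eq_vecForm {p : ℕ}
    (B B' : Fin (p + 1) → Fin (p + 1) → MvPolynomial (Fin (p + 1)) ℂ) :
    ∑ a, ∑ b, (B a b • (vol (p + 1)).curryLeft (Pi.single b 1) -
      B' a b • (vol (p + 1)).curryLeft (Pi.single a 1)) =
      vecForm fun b => ∑ a, (B a b - B' b a) :=
  sum_sum_smul_sub B B' fun a => (vol (p + 1)).curryLeft (Pi.single a 1)

theorem wedgeLeft_bivecForm {p : ℕ}
    (α : (Fin (p + 2) → ℂ) →ₗ[ℂ] MvPolynomial (Fin (p + 2)) ℂ)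
    (A : Fin (p + 2) → Fin (p + 2) → MvPolynomial (Fin (p + 2)) ℂ) :
    wedgeLeft α (bivecForm A) =
      vecForm fun b => ∑ a, α (Pi.single a 1) * (A a b - A b a) := by
  simp only [bivecForm, map_sum, wedgeLeft_smul, wedgeLeft_curryLeft_curryLeft_vol, smul_sub,
    smul_smul, sum_smul_sub_eq_vecForm]
  simp only [mul_comm (α _), sub_mul]

theorem extD_bivecForm {p : ℕ}
    (A : Fin (p + 2) → Fin (p + 2) → MvPolynomial (Fin (p + 2)) ℂ) :
    extD (bivecForm A) = vecForm fun b => ∑ a, pderiv a (A a b - A b a) := by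
  have h (a b : Fin (p + 2)) :
      extD (((vol (p + 2)).curryLeft (Pi.single b 1)).curryLeft (Pi.single a 1)) = 0 :=
    extD_eq_zero_of_const _ fun v => exists_vol_apply_eq_C _
  simp only [bivecForm, map_sum, extD_smul, wedgeLeft_curryLeft_curryLeft_vol, h, smul_zero,
    add_zero, differential_single, sum_smul_sub_eq_vecForm, map_sub]

theorem differential_quad_single {n : ℕ} (a : Fin n) :
    differential (quad n) (Pi.single a 1) = 2 * X a := by
  simp only [differential_single, quad, map_sum, pderiv_pow, pderiv_X]
  simp [Pi.single_apply]

/-- On vector fields `D'_q` is the operator `ξ ↦ h div ξ - 2q ∑ₐ zₐ ξₐ`. -/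
theorem twistedD_vecForm {p : ℕ} (q : ℤ) (ξ : Fin (p + 1) → MvPolynomial (Fin (p + 1)) ℂ) :
    twistedD q (vecForm ξ) =
      (quad (p + 1) * ∑ a, pderiv a (ξ a) - (2 * q : ℤ) * ∑ a, X a * ξ a) • vol (p + 1) := by
  rw [twistedD_apply, extD_vecForm, wedgeLeft_vecForm, ← Int.cast_smul_eq_zsmul
    (MvPolynomial (Fin (p + 1)) ℂ), smul_smul, smul_smul, ← sub_smul]
  simp only [differential_quad_single, mul_assoc, ← Finset.mul_sum]
  push_cast
  congr 2
  ring

/-- On bivector fields `B`, `D'_q` is the operator `B ↦ h div B - 2q z · B`, where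
`(div B)_b = ∑ₐ ∂ₐ B_{ab}` and `(z · B)_b = ∑ₐ zₐ B_{ab}`. -/
theorem twistedD_bivecForm {p : ℕ} (q : ℤ)
    (A : Fin (p + 2) → Fin (p + 2) → MvPolynomial (Fin (p + 2)) ℂ) :
    twistedD q (bivecForm A) = vecForm fun b =>
      quad (p + 2) * ∑ a, pderiv a (A a b - A b a) -
        (2 * q : ℤ) * ∑ a, X a * (A a b - A b a) := by
  rw [twistedD_apply, extD_bivecForm, wedgeLeft_bivecForm, ← Int.cast_smul_eq_zsmul
    (MvPolynomial (Fin (p + 2)) ℂ)]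
  simp only [vecForm, Finset.smul_sum, ← Finset.sum_sub_distrib]
  refine Finset.sum_congr rfl fun b _ => ?_
  rw [smul_smul, smul_smul, ← sub_smul]
  simp only [differential_quad_single, mul_assoc, ← Finset.mul_sum]
  push_cast
  congr 2
  ring


theorem sum_form_apply {n p : ℕ} {ι : Type*} (s : Finset ι) (f : ι → PolyForm n p)
    (v : Fin p → Fin n → ℂ) : (∑ i ∈ s, f i) v = ∑ i ∈ s, f i v :=
  map_sum (g := ({ toFun := fun ω => ω v, map_zero' := rfl, map_add' := fun _ _ => rfl } :
    PolyForm n p →+ MvPolynomial (Fin n) ℂ)) f s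

theorem sum_differential_X_mul {n p : ℕ} (ω : PolyForm n (p + 1)) (x : Fin n → ℂ)
    (v : Fin p → Fin n → ℂ) :
    ∑ a, differential (X a) x * ω (Matrix.vecCons (Pi.single a 1) v) = ω (Matrix.vecCons x v) := by
  have hx : x = ∑ a, x a • Pi.single a 1 := by
    ext1 i; simp [Finset.sum_apply, Pi.single_apply]
  rw [← AlternatingMap.curryLeft_apply_apply, hx, map_sum, sum_form_apply, ← hx]
  refine Finset.sum_congr rfl fun a _ => ?_
  have hd : differential (X a) x = C (x a) := by
    simp [differential_apply, pderiv_X, Pi.single_apply, smul_eq_C_mul]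
  rw [hd, map_smul, AlternatingMap.smul_apply, smul_eq_C_mul, AlternatingMap.curryLeft_apply_apply]

/-- `∑ₐ dzₐ ∧ ι_a ω = (deg ω) ω`. -/
theorem sum_wedgeLeft_X_curryLeft {n p : ℕ} (ω : PolyForm n (p + 1)) :
    ∑ a, wedgeLeft (differential (X a)) (ω.curryLeft (Pi.single a 1)) = (p + 1) • ω := by
  rw [← AlternatingMap.alternatizeUncurryFin_curryLeft]
  ext1 v
  simp only [sum_form_apply, wedgeLeft_apply, AlternatingMap.curryLeft_apply_apply,
    AlternatingMap.alternatizeUncurryFin_apply]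
  rw [Finset.sum_comm]
  simp only [← Finset.mul_sum, sum_differential_X_mul]
  simp

/-- Every form of codegree one is `ι_ξ vol`, with `dzₐ ∧ ω = ξₐ vol`. Summing
`ι_a (dzₐ ∧ ω) = ω - dzₐ ∧ ι_a ω` over `a` gives `(p + 1) ω - p ω = ω`. -/
theorem eq_vecForm {p : ℕ} (ω : PolyForm (p + 1) p) :
    ω = vecForm fun a => wedgeLeft (differential (X a)) ω fun i => Pi.single i 1 := by
  have h (a : Fin (p + 1)) :
      wedgeLeft (differential (X a)) ω (fun i => Pi.single i 1) •
        (vol (p + 1)).curryLeft (Pi.single a 1) =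
      (wedgeLeft (differential (X a)) ω).curryLeft (Pi.single a 1) := by
    conv_rhs => rw [eq_smul_vol (wedgeLeft (differential (X a)) ω)]
    rfl
  simp only [vecForm, h]
  cases p with
  | zero =>
    ext1 v
    simp [wedgeLeft_apply, differential_single]
  | succ p =>
    have h2 (a : Fin (p + 2)) : (wedgeLeft (differential (X a)) ω).curryLeft (Pi.single a 1) =
        ω - wedgeLeft (differential (X a)) (ω.curryLeft (Pi.single a 1)) := by
      rw [wedgeLeft_curryLeft, differential_single, pderiv_X_self, one_smul, sub_sub_cancel]
    simp only [h2, Finset.sum_sub_distrib, sum_wedgeLeft_X_curryLeft]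
    simp [add_smul]

/-! ### Homogeneity with integer degrees -/

/-- `f` is homogeneous of degree `m`, where `m` is an integer, so that `f = 0` if `m < 0`. -/
abbrev Homog {n : ℕ} (f : MvPolynomial (Fin n) ℂ) (m : ℤ) : Prop :=
  IsWeightedHomogeneous (fun _ : Fin n => (1 : ℤ)) f m

theorem homog_of_eq {n : ℕ} {f : MvPolynomial (Fin n) ℂ} {m m' : ℤ} (hf : Homog f m)
    (h : m = m') : Homog f m' :=
  h ▸ hf

theorem Homog.pderiv {n : ℕ} {f : MvPolynomial (Fin n) ℂ} {m : ℤ} (hf : Homog f m) (i : Fin n) :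
    Homog (pderiv i f) (m - 1) :=
  IsWeightedHomogeneous.pderiv hf (sub_add_cancel m 1)

theorem Homog.smul {n : ℕ} {f : MvPolynomial (Fin n) ℂ} {m : ℤ} (c : ℂ) (hf : Homog f m) :
    Homog (c • f) m :=
  (weightedHomogeneousSubmodule ℂ (fun _ : Fin n => (1 : ℤ)) m).smul_mem c hf

theorem Homog.intCast_mul {n : ℕ} {f : MvPolynomial (Fin n) ℂ} {m : ℤ} (c : ℤ) (hf : Homog f m) :
    Homog ((c : MvPolynomial (Fin n) ℂ) * f) m := by
  rw [← zsmul_eq_mul]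
  exact zsmul_mem (K := weightedHomogeneousSubmodule ℂ (fun _ : Fin n => (1 : ℤ)) m) hf c

theorem homog_X {n : ℕ} (i : Fin n) : Homog (X i) 1 :=
  isWeightedHomogeneous_X _ _ i

theorem homog_quad (n : ℕ) : Homog (quad n) 2 :=
  IsWeightedHomogeneous.sum _ _ _ fun i _ => by simpa using (homog_X i).pow 2

theorem Homog.exists_isHomogeneous {n : ℕ} {f : MvPolynomial (Fin n) ℂ} {m : ℤ} (hf : Homog f m)
    (h0 : f ≠ 0) : ∃ k : ℕ, m = k ∧ f.IsHomogeneous k := by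
  have hw (d : Fin n →₀ ℕ) : Finsupp.weight (fun _ : Fin n => (1 : ℤ)) d =
      (Finsupp.weight (1 : Fin n → ℕ) d : ℤ) := by
    simp [Finsupp.weight_apply, Finsupp.sum]
  obtain ⟨d, hd⟩ := ne_zero_iff.1 h0
  refine ⟨Finsupp.weight (1 : Fin n → ℕ) d, by rw [← hw, hf hd], fun e he => ?_⟩
  have := (hf he).trans (hf hd).symm
  rw [hw, hw] at this
  exact_mod_cast this

/-- Euler's identity. -/
theorem Homog.euler {n : ℕ} {f : MvPolynomial (Fin n) ℂ} {m : ℤ} (hf : Homog f m) :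
    ∑ i, X i * MvPolynomial.pderiv i f = (m : MvPolynomial (Fin n) ℂ) * f := by
  by_cases h0 : f = 0
  · simp [h0]
  obtain ⟨k, rfl, hk⟩ := hf.exists_isHomogeneous h0
  simp [hk.sum_X_mul_pderiv]

theorem Homog.eq_zero {n : ℕ} {f : MvPolynomial (Fin n) ℂ} {m : ℤ} (hf : Homog f m)
    (hm : m < 0) : f = 0 := by
  by_contra h0
  obtain ⟨k, rfl, -⟩ := hf.exists_isHomogeneous h0
  omega

theorem homog_neg_one_pow_mul {n : ℕ} {f : MvPolynomial (Fin n) ℂ} {m : ℤ} (k : ℕ)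
    (hf : Homog f m) : Homog ((-1) ^ k * f) m := by
  simpa using Homog.intCast_mul ((-1) ^ k) hf

theorem homog_dirDeriv {n : ℕ} {f : MvPolynomial (Fin n) ℂ} {m : ℤ} (hf : Homog f m)
    (x : Fin n → ℂ) : Homog (dirDeriv n x f) (m - 1) := by
  rw [dirDeriv_apply]
  exact IsWeightedHomogeneous.sum _ _ _ fun i _ => (hf.pderiv i).smul _

theorem extD_mem_degPart {n p : ℕ} {j : ℤ} {ω : PolyForm n p} (hω : ω ∈ degPart n p j) :
    extD ω ∈ degPart n (p + 1) j := fun v => by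
  rw [extD_apply]
  refine IsWeightedHomogeneous.sum _ _ _ fun i _ => homog_neg_one_pow_mul _ ?_
  exact homog_of_eq (homog_dirDeriv (hω _) _) (by push_cast; ring)

theorem wedgeLeft_differential_mem_degPart {n p : ℕ} {j m : ℤ} {f : MvPolynomial (Fin n) ℂ}
    {ω : PolyForm n p} (hf : Homog f m) (hω : ω ∈ degPart n p j) :
    wedgeLeft (differential f) ω ∈ degPart n (p + 1) (j + m) := fun v => by
  rw [wedgeLeft_apply]
  refine IsWeightedHomogeneous.sum _ _ _ fun i _ => homog_neg_one_pow_mul _ ?_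
  exact homog_of_eq ((homog_dirDeriv hf (v i)).mul (hω (i.removeNth v))) (by push_cast; ring)

theorem smul_mem_degPart {n p : ℕ} {j m : ℤ} {f : MvPolynomial (Fin n) ℂ}
    {ω : PolyForm n p} (hf : Homog f m) (hω : ω ∈ degPart n p j) :
    f • ω ∈ degPart n p (j + m) := fun v =>
  homog_of_eq (hf.mul (hω v)) (by ring)

theorem twistedD_mem_degPart {n p : ℕ} {j : ℤ} (q : ℤ) {ω : PolyForm n p}
    (hω : ω ∈ degPart n p j) : twistedD q ω ∈ degPart n (p + 1) (j + 2) :=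
  Submodule.sub_mem _ (smul_mem_degPart (homog_quad n) (extD_mem_degPart hω))
    (zsmul_mem (wedgeLeft_differential_mem_degPart (homog_quad n) hω) q)

theorem vol_apply_homog {n : ℕ} (v : Fin n → Fin n → ℂ) : Homog (vol n v) 0 := by
  obtain ⟨c, hc⟩ := exists_vol_apply_eq_C v
  rw [hc]
  exact isWeightedHomogeneous_C _ c

theorem vecForm_mem_degPart {p : ℕ} {m : ℤ} {ξ : Fin (p + 1) → MvPolynomial (Fin (p + 1)) ℂ}
    (hξ : ∀ a, Homog (ξ a) m) : vecForm ξ ∈ degPart (p + 1) p (p + m) :=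
  Submodule.sum_mem _ fun a _ => smul_mem_degPart (hξ a) fun v => by
    simpa using vol_apply_homog _

theorem bivecForm_mem_degPart {p : ℕ} {m : ℤ}
    {A : Fin (p + 2) → Fin (p + 2) → MvPolynomial (Fin (p + 2)) ℂ}
    (hA : ∀ a b, Homog (A a b) m) : bivecForm A ∈ degPart (p + 2) p (p + m) :=
  Submodule.sum_mem _ fun a _ => Submodule.sum_mem _ fun b _ =>
    smul_mem_degPart (hA a b) fun v => by simpa using vol_apply_homog _

theorem exists_eq_vecForm {p : ℕ} {j : ℤ} {ω : PolyForm (p + 1) p}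
    (hω : ω ∈ degPart (p + 1) p j) :
    ∃ ξ : Fin (p + 1) → MvPolynomial (Fin (p + 1)) ℂ, (∀ a, Homog (ξ a) (j - p)) ∧
      ω = vecForm ξ := by
  refine ⟨_, fun a => ?_, eq_vecForm ω⟩
  exact homog_of_eq (wedgeLeft_differential_mem_degPart (homog_X a) hω _) (by push_cast; ring)

/-! ### Surjectivity in top degree -/

theorem sum_X_mul_X {n : ℕ} : ∑ a : Fin n, X a * X a = quad n := by
  simp [quad, sq]

/-- The divergence of `g E`, where `E = ∑ₐ zₐ ∂ₐ` is the Euler field. -/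
theorem sum_pderiv_X_mul {n : ℕ} {g : MvPolynomial (Fin n) ℂ} {m : ℤ} (hg : Homog g m) :
    ∑ a, pderiv a (X a * g) = ((n + m : ℤ) : MvPolynomial (Fin n) ℂ) * g := by
  simp only [pderiv_mul, pderiv_X_self, one_mul, Finset.sum_add_distrib, hg.euler]
  simp
  ring

theorem intCast_mul_inv_smul {n : ℕ} {c : ℤ} (hc : c ≠ 0) (f : MvPolynomial (Fin n) ℂ) :
    (c : MvPolynomial (Fin n) ℂ) * ((c : ℂ)⁻¹ • f) = f := by
  have hc' : (c : ℂ) ≠ 0 := by exact_mod_cast hc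
  rw [← map_intCast (C : ℂ →+* MvPolynomial (Fin n) ℂ), ← smul_eq_C_mul, smul_smul,
    mul_inv_cancel₀ hc', one_smul]

/-- Modulo `h`, Euler's identity makes any `f` of positive degree a multiple `-2q z · ζ`; the error
`h div ζ` is removed by a multiple of the Euler field, as `g E` is sent to `(j - 2q) h g`. -/
theorem exists_vector_field {n : ℕ} {f : MvPolynomial (Fin n) ℂ} {j q : ℤ} (hj : j ≠ 2 * q)
    (hq : 2 * q ≠ 0) (hjn : n < j + 2) (hf : Homog f (j + 2 - n)) :
    ∃ ξ : Fin n → MvPolynomial (Fin n) ℂ, (∀ a, Homog (ξ a) (j + 1 - n)) ∧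
      quad n * ∑ a, pderiv a (ξ a) - (2 * q : ℤ) * ∑ a, X a * ξ a = f := by
  have hm : j + 2 - (n : ℤ) ≠ 0 := by omega
  obtain ⟨ζ, hζ, hζf⟩ : ∃ ζ : Fin n → MvPolynomial (Fin n) ℂ,
      (∀ a, Homog (ζ a) (j + 1 - n)) ∧
        ((2 * q : ℤ) : MvPolynomial (Fin n) ℂ) * ∑ a, X a * ζ a = -f := by
    refine ⟨fun a => ((2 * q : ℤ) : ℂ)⁻¹ • ((j + 2 - n : ℤ) : ℂ)⁻¹ • -pderiv a f,
      fun a => Homog.smul _ (Homog.smul _ (homog_of_eq (hf.pderiv a) (by ring)).neg), ?_⟩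
    simp only [mul_smul_comm, ← Finset.smul_sum, mul_neg, Finset.sum_neg_distrib, hf.euler]
    rw [mul_left_comm, ← mul_neg, ← mul_smul_comm, intCast_mul_inv_smul hm, ← mul_neg,
      ← mul_smul_comm, intCast_mul_inv_smul hq]
  -- The coefficient `-(j - 2q)⁻¹ δ` of the Euler field compensates the term `h δ`.
  set δ := ∑ a, pderiv a (ζ a) with hδ
  have hδh : Homog δ (j - n) := by
    exact IsWeightedHomogeneous.sum _ _ _ fun a _ => homog_of_eq ((hζ a).pderiv a) (by ring)
  refine ⟨fun a => ζ a - X a * (((j - 2 * q : ℤ) : ℂ)⁻¹ • δ), fun a => (hζ a).sub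
    (homog_of_eq ((homog_X a).mul (hδh.smul ((j - 2 * q : ℤ) : ℂ)⁻¹)) (by ring)), ?_⟩
  · have hc : ((j - 2 * q : ℤ) : MvPolynomial (Fin n) ℂ) * (((j - 2 * q : ℤ) : ℂ)⁻¹ • δ) = δ :=
      intCast_mul_inv_smul (sub_ne_zero.2 hj) _
    have hg := hδh.smul ((j - 2 * q : ℤ) : ℂ)⁻¹
    generalize ((j - 2 * q : ℤ) : ℂ)⁻¹ • δ = g at hc hg
    simp only [map_sub, mul_sub, Finset.sum_sub_distrib, sum_pderiv_X_mul hg, hζf, ← hδ,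
      ← mul_assoc, ← Finset.sum_mul, sum_X_mul_X]
    rw [← hc]
    push_cast
    ring

theorem map_twistedD_degPart {p : ℕ} {j q : ℤ} (hj : j ≠ 2 * q) (hq : 2 * q ≠ 0)
    (hjn : ((p + 1 : ℕ) : ℤ) < j + 2) :
    (degPart (p + 1) p j).map (twistedD q) = degPart (p + 1) (p + 1) (j + 2) := by
  refine le_antisymm (Submodule.map_le_iff_le_comap.2 fun ω hω => twistedD_mem_degPart q hω)
    fun η hη => ?_
  obtain ⟨ξ, hξ, h⟩ := exists_vector_field hj hq hjn (hη fun i => Pi.single i 1)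
  refine ⟨vecForm ξ, ?_, ?_⟩
  · have := vecForm_mem_degPart hξ
    rwa [show (p : ℤ) + (j + 1 - (p + 1 : ℕ)) = j by push_cast; ring] at this
  · rw [twistedD_vecForm, h, ← eq_smul_vol]

/-! ### Exactness in codegree one -/

theorem sum_pderiv_X_mul_eq {n : ℕ} (b : Fin n) (u : Fin n → MvPolynomial (Fin n) ℂ) :
    ∑ a, pderiv b (X a) * u a = u b := by
  simp [pderiv_X, Pi.single_apply]

/-- Exactness of the Koszul complex of `z₁, …, z_n` at vector fields: if `∑ₐ zₐ ξₐ = 0`, then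
`ξ = z · B` for the bivector field `B_{ab} = (∂ₐ ξ_b - ∂_b ξₐ) / (d + 1)`, by Euler's identity. -/
theorem exists_sum_X_mul_sub_eq {n : ℕ} {ξ : Fin n → MvPolynomial (Fin n) ℂ} {d : ℤ}
    (hξ : ∀ a, Homog (ξ a) d) (h0 : ∑ a, X a * ξ a = 0) :
    ∃ P : Fin n → Fin n → MvPolynomial (Fin n) ℂ, (∀ a b, Homog (P a b) (d - 1)) ∧
      ∀ b, ∑ a, X a * (P a b - P b a) = ξ b := by
  -- The denominator vanishes for `d = -1`, but then `ξ = 0`.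
  by_cases hd : d + 1 = 0
  · refine ⟨fun _ _ => 0, fun _ _ => isWeightedHomogeneous_zero _ _ _, fun b => ?_⟩
    simp [(hξ b).eq_zero (show d < 0 by omega)]
  refine ⟨fun a b => ((d + 1 : ℤ) : ℂ)⁻¹ • pderiv a (ξ b),
    fun a b => ((hξ b).pderiv a).smul _, fun b => ?_⟩
  have h1 : ∑ a, X a * pderiv b (ξ a) = -ξ b := by
    have := congr(pderiv b $h0)
    simp only [map_sum, pderiv_mul, Finset.sum_add_distrib, map_zero, sum_pderiv_X_mul_eq] at this
    exact eq_neg_of_add_eq_zero_right this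
  have h2 : ∑ a, X a * (pderiv a (ξ b) - pderiv b (ξ a)) =
      ((d + 1 : ℤ) : MvPolynomial (Fin n) ℂ) * ξ b := by
    simp only [mul_sub, Finset.sum_sub_distrib, (hξ b).euler, h1]
    push_cast
    ring
  simp only [← smul_sub, mul_smul_comm, ← Finset.smul_sum]
  rw [h2, ← mul_smul_comm, intCast_mul_inv_smul hd]

/-- A homogeneous vector field `ξ` with `h div ξ = 2q z · ξ` is of the form
`h div B - 2(q - 1) z · B` for a homogeneous bivector field `B = A - Aᵀ`. -/
theorem exists_bivector_field {n : ℕ} {ξ : Fin n → MvPolynomial (Fin n) ℂ} {j q : ℤ}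
    (hj : j ≠ 2 * q) (hq : 2 * q ≠ 0) (hq1 : q ≠ 1) (hξ : ∀ a, Homog (ξ a) (j + 1 - n))
    (hker : quad n * ∑ a, pderiv a (ξ a) - (2 * q : ℤ) * ∑ a, X a * ξ a = 0) :
    ∃ A : Fin n → Fin n → MvPolynomial (Fin n) ℂ, (∀ a b, Homog (A a b) (j - n)) ∧
      ∀ b, quad n * ∑ a, pderiv a (A a b - A b a) -
        (2 * (q - 1) : ℤ) * ∑ a, X a * (A a b - A b a) = ξ b := by
  have hq1' : 2 * (q - 1) ≠ 0 := by omega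
  have hjq : j - 2 * q ≠ 0 := sub_ne_zero.2 hj
  have cancel {c : ℤ} (hc : c ≠ 0) {f g : MvPolynomial (Fin n) ℂ}
      (h : (c : MvPolynomial (Fin n) ℂ) * f = c * g) : f = g :=
    mul_left_cancel₀ (by exact_mod_cast hc) h
  -- The kernel equation says that `z · ξ = h g` with `g = div ξ / (2q)`, so that `ξ - g E` is
  -- annihilated by `z ·` and the Koszul complex applies to it.
  obtain ⟨g, hg, hdiv⟩ : ∃ g, Homog g (j - n) ∧
      ((2 * q : ℤ) : MvPolynomial (Fin n) ℂ) * g = ∑ a, pderiv a (ξ a) := by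
    refine ⟨((2 * q : ℤ) : ℂ)⁻¹ • ∑ a, pderiv a (ξ a), ?_, intCast_mul_inv_smul hq _⟩
    exact Homog.smul _ (IsWeightedHomogeneous.sum _ _ _ fun a _ =>
      homog_of_eq ((hξ a).pderiv a) (by ring))
  have hXξ : ∑ a, X a * ξ a = quad n * g := by
    refine cancel hq ?_
    rw [mul_left_comm, hdiv]
    exact (sub_eq_zero.1 hker).symm
  obtain ⟨P, hP, hPξ⟩ := exists_sum_X_mul_sub_eq (ξ := fun a => ξ a - X a * g) (d := j + 1 - n)
    (fun a => (hξ a).sub (homog_of_eq ((homog_X a).mul hg) (by ring)))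
    (by simp only [mul_sub, Finset.sum_sub_distrib, hXξ, ← mul_assoc, ← Finset.sum_mul,
          sum_X_mul_X, sub_self])
  have hP' a b : Homog (P a b) (j - n) := homog_of_eq (hP a b) (by ring)
  -- `B = Q - Qᵀ` solves `-2(q - 1) z · B = ξ - g E`; what is left over is `g E - h w` with
  -- `w = div B`.
  obtain ⟨Q, hQ, hQP⟩ : ∃ Q : Fin n → Fin n → MvPolynomial (Fin n) ℂ,
      (∀ a b, Homog (Q a b) (j - n)) ∧
      ∀ a b, ((2 * (q - 1) : ℤ) : MvPolynomial (Fin n) ℂ) * Q a b = - P a b :=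
    ⟨fun a b => ((2 * (q - 1) : ℤ) : ℂ)⁻¹ • -P a b, fun a b => Homog.smul _ (hP' a b).neg,
      fun a b => intCast_mul_inv_smul hq1' _⟩
  have hQξ b : ((2 * (q - 1) : ℤ) : MvPolynomial (Fin n) ℂ) * ∑ a, X a * (Q a b - Q b a) =
      X b * g - ξ b := by
    rw [← neg_sub (ξ b), ← hPξ, Finset.mul_sum, ← Finset.sum_neg_distrib]
    refine Finset.sum_congr rfl fun a _ => ?_
    rw [mul_left_comm, mul_sub, hQP, hQP]
    ring
  set w : Fin n → MvPolynomial (Fin n) ℂ := fun b => ∑ a, pderiv a (Q a b - Q b a) with hw_def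
  have hw b : Homog (w b) (j - n - 1) :=
    IsWeightedHomogeneous.sum _ _ _ fun a _ => Homog.pderiv ((hQ a b).sub (hQ b a)) a
  have hwdiv : ∑ b, pderiv b (w b) = 0 := by
    simp only [hw_def, map_sum, map_sub, Finset.sum_sub_distrib]
    rw [sub_eq_zero, Finset.sum_comm]
    refine Finset.sum_congr rfl fun a _ => Finset.sum_congr rfl fun b _ => pderiv_comm _ _ _
  have hXw : ∑ b, X b * w b = -∑ b, pderiv b (∑ a, X a * (Q a b - Q b a)) := by
    simp only [map_sum, pderiv_mul, Finset.sum_add_distrib, sum_pderiv_X_mul_eq, sub_self,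
      zero_add]
    rw [Finset.sum_comm, ← Finset.sum_neg_distrib]
    refine Finset.sum_congr rfl fun b _ => ?_
    rw [hw_def, ← Finset.mul_sum, ← mul_neg, ← Finset.sum_neg_distrib]
    congr 1
    refine Finset.sum_congr rfl fun a _ => ?_
    rw [← map_neg, neg_sub]
  -- Taking divergences in `ξ = g E - 2(q - 1) z · B` expresses `g` through `w`.
  have hgw : ((j - 2 * q : ℤ) : MvPolynomial (Fin n) ℂ) * g =
      -((2 * (q - 1) : ℤ) * ∑ b, X b * w b) := by
    have h1 : ((2 * (q - 1) : ℤ) : MvPolynomial (Fin n) ℂ) *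
        ∑ b, pderiv b (∑ a, X a * (Q a b - Q b a)) = ∑ b, pderiv b (X b * g) -
          ∑ b, pderiv b (ξ b) := by
      rw [← Finset.sum_sub_distrib, Finset.mul_sum]
      refine Finset.sum_congr rfl fun b _ => ?_
      rw [← map_sub, ← hQξ, ← zsmul_eq_mul, ← zsmul_eq_mul, map_zsmul]
    rw [hXw, mul_neg, neg_neg, h1, sum_pderiv_X_mul hg, ← hdiv]
    push_cast
    ring
  -- The remainder `g E - h w` is the image of `E ∧ u` for `u = -w / (j - 2q)`, because `div u = 0`.
  obtain ⟨u, hu, huw⟩ : ∃ u : Fin n → MvPolynomial (Fin n) ℂ,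
      (∀ b, Homog (u b) (j - n - 1)) ∧
      ∀ b, ((j - 2 * q : ℤ) : MvPolynomial (Fin n) ℂ) * u b = -w b :=
    ⟨fun b => ((j - 2 * q : ℤ) : ℂ)⁻¹ • -w b, fun b => Homog.smul _ (hw b).neg,
      fun b => intCast_mul_inv_smul hjq _⟩
  have hudiv : ∑ b, pderiv b (u b) = 0 := by
    refine cancel hjq ?_
    have h1 b : ((j - 2 * q : ℤ) : MvPolynomial (Fin n) ℂ) * pderiv b (u b) = -pderiv b (w b) := by
      rw [← map_neg, ← huw, ← zsmul_eq_mul, ← zsmul_eq_mul, map_zsmul]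
    rw [Finset.mul_sum]
    simp only [h1, Finset.sum_neg_distrib, hwdiv, neg_zero, mul_zero]
  have hgu : g = (2 * (q - 1) : ℤ) * ∑ b, X b * u b := by
    refine cancel hjq ?_
    rw [hgw, mul_left_comm, Finset.mul_sum _ _ ((j - 2 * q : ℤ) : MvPolynomial (Fin n) ℂ)]
    simp only [mul_left_comm _ (X _), huw, mul_neg, Finset.sum_neg_distrib]
  refine ⟨fun a b => Q a b + X a * u b, fun a b => (hQ a b).add
    (homog_of_eq ((homog_X a).mul (hu b)) (by ring)), fun b => ?_⟩
  have e1 : ∑ a, X a * (Q a b + X a * u b - (Q b a + X b * u a)) =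
      ∑ a, X a * (Q a b - Q b a) + (quad n * u b - X b * ∑ a, X a * u a) := by
    rw [← sum_X_mul_X, Finset.sum_mul, Finset.mul_sum, ← Finset.sum_sub_distrib,
      ← Finset.sum_add_distrib]
    exact Finset.sum_congr rfl fun a _ => by ring
  have e2 : ∑ a, pderiv a (Q a b + X a * u b - (Q b a + X b * u a)) =
      w b + ((j - 2 : ℤ) : MvPolynomial (Fin n) ℂ) * u b := by
    have h1 : ∑ a, pderiv a (X b * u a) = u b := by
      simp only [pderiv_mul, Finset.sum_add_distrib, ← Finset.mul_sum, hudiv]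
      simp [pderiv_X, Pi.single_apply]
    have h2 : ∑ a, pderiv a (Q a b + X a * u b - (Q b a + X b * u a)) =
        w b + (∑ a, pderiv a (X a * u b) - ∑ a, pderiv a (X b * u a)) := by
      rw [hw_def, ← Finset.sum_sub_distrib, ← Finset.sum_add_distrib]
      refine Finset.sum_congr rfl fun a _ => ?_
      simp only [map_sub, map_add]
      ring
    rw [h2, h1, sum_pderiv_X_mul (hu b)]
    push_cast
    ring
  have hwu := huw b
  have hQb := hQξ b
  rw [e1, e2, mul_add _ _ (quad n * _ - _), hQb]
  rw [show w b = -(((j - 2 * q : ℤ) : MvPolynomial (Fin n) ℂ) * u b) by rw [hwu, neg_neg]]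
  conv_lhs => enter [2]; rw [hgu]
  push_cast
  ring

theorem imageTwistedD_eq {p : ℕ} {j q : ℤ} (hj : j ≠ 2 * q) (hq : 2 * q ≠ 0) (hq1 : q ≠ 1) :
    imageTwistedD (p + 1) (q - 1) (j - 2) p =
      degPart (p + 1) p j ⊓ LinearMap.ker (twistedD q) := by
  refine le_antisymm ?_ fun η ⟨hη, hker⟩ => ?_
  · cases p with
    | zero => exact bot_le
    | succ p =>
      refine Submodule.map_le_iff_le_comap.2 fun ω hω => ⟨?_, ?_⟩
      · simpa using twistedD_mem_degPart (q - 1) hω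
      · exact twistedD_twistedD_sub_one q ω
  · obtain ⟨ξ, hξ, rfl⟩ := exists_eq_vecForm hη
    have hscal := congr($(LinearMap.mem_ker.1 hker) fun i => Pi.single i 1)
    rw [twistedD_vecForm, AlternatingMap.smul_apply, vol_single, smul_eq_mul, mul_one,
      AlternatingMap.zero_apply] at hscal
    obtain ⟨A, hA, hAξ⟩ := exists_bivector_field hj hq hq1
      (fun a => homog_of_eq (hξ a) (by push_cast; ring)) hscal
    cases p with
    | zero =>
      -- In one variable every bivector field is zero, hence so is `ξ`.
      have : ξ = 0 := by
        ext1 b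
        obtain rfl : b = 0 := Fin.fin_one_eq_zero b
        rw [← hAξ 0]
        simp
      simp [imageTwistedD, this, vecForm]
    | succ p =>
      refine ⟨bivecForm A, ?_, ?_⟩
      · have := bivecForm_mem_degPart hA
        rwa [show (p : ℤ) + (j - (p + 1 + 1 : ℕ)) = j - 2 by push_cast; ring] at this
      · rw [twistedD_bivecForm]
        exact congrArg vecForm (funext hAξ)

end PolyForm

theorem lemma4p2 (n p : ℕ) (hn : n = p + 1) (j q : ℤ) (hj : j ≠ 2 * q) (hq : 2 * q ≠ 0) :
    (j + 2 > n →
      (PolyForm.degPart n p j).map (PolyForm.twistedD q) =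
        PolyForm.degPart n (p + 1) (j + 2)) ∧
    (q ≠ 1 →
      PolyForm.imageTwistedD n (q - 1) (j - 2) p =
        PolyForm.degPart n p j ⊓ LinearMap.ker (PolyForm.twistedD q)) := by
  subst hn
  exact ⟨PolyForm.map_twistedD_degPart hj hq, PolyForm.imageTwistedD_eq hj hq⟩
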